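/- Let $0<s<1$, $G_s=\{z\in\mathbb C: s<|z|<1\}$ and $\partial G_s=s\mathbb T\cup\mathbb T$, where $\mathbb T$ is the unit circle; let $\mu$ be the Lebesgue measure on $\partial G_s$, normalized so that $\mathbb T$ and $s\mathbb T$ each have measure $1$. Let $H^\infty(G_s)$ be the space of bounded analytic functions on $G_s$; such a function has boundary values (radial limits) almost everywhere on $\partial G_s$, which are denoted by the same letter. For an integer $k\ge 0$ let $H^{k,\infty}(\partial G_s)=H^{k,\infty}(G_s)$ be the space of all $f\in H^\infty(G_s)$ whose complex derivatives $f^{(i)}$, $0\le i\le k$, all lie in $H^\infty(G_s)$, with the norm $$\|f\|_{H^{k,\infty}(\partial G_s)}=\max_{0\le i\le k}\left(\|f^{(i)}\|_{L^\infty(s\mathbb T)}+\|f^{(i)}\|_{L^\infty(\mathbb T)}\right).$$ For a nonempty, connected, relatively open set $I\subset\partial G_s$ put $\|f\|_{L^1(I)}=\frac1{\mu(I)}\int_I|f|\,d\mu$. Let $j,k$ be integers with $0\le j<k$, let $I\subset\partial G_s$ be nonempty, connected and relatively open, and let $(f_p)_{p\in\mathbb N}$ be a sequence in the closed unit ball of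 $H^{k,\infty}(\partial G_s)$ such that $\|f_p\|_{L^1(I)}\to 0$ as $p\to\infty$. Then $\|f_p\|_{H^{j,\infty}(\partial G_s)}\to 0$ as $p\to\infty$. -/

import Mathlib

open Filter Topology MeasureTheory
open scoped ENNReal

noncomputable section

/-- The open annulus `G_s = {z : s < |z| < 1}`. -/
def annulus (s : ℝ) : Set ℂ := {z | s < ‖z‖ ∧ ‖z‖ < 1}

/-- The boundary `∂G_s = s𝕋 ∪ 𝕋` of the annulus (for `0 < s < 1`). -/
def annulusBoundary (s : ℝ) : Set ℂ := Metric.sphere 0 s ∪ Metric.sphere 0 1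

/-- Lebesgue measure `dθ / 2π` on the circle `r𝕋`, of total mass one, as a measure on `ℂ`. -/
def circleMeasure (r : ℝ) : Measure ℂ :=
  ENNReal.ofReal (2 * Real.pi)⁻¹ •
    Measure.map (fun θ : ℝ => (r : ℂ) * Complex.exp (θ * Complex.I))
      (volume.restrict (Set.Ioc 0 (2 * Real.pi)))

/-- The measure `μ` on `∂G_s`, for which `𝕋` and `s𝕋` each have unit measure. -/
def boundaryMeasure (s : ℝ) : Measure ℂ := circleMeasure s + circleMeasure 1

/-- The boundary value of a function `g` on `G_s` at a point `z ∈ ∂G_s`: the radial limit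
`lim g (ρ z / |z|)` as `ρ → |z|`, `s < ρ < 1`. For bounded analytic `g` it exists at almost every
boundary point. -/
def boundaryValue (s : ℝ) (g : ℂ → ℂ) (z : ℂ) : ℂ :=
  limUnder (𝓝[Set.Ioo s 1] ‖z‖) (fun ρ : ℝ => g ((ρ : ℂ) * (z / (‖z‖ : ℂ))))

/-- `g ∈ H^∞(G_s)`: bounded and analytic on the annulus (only the values on `G_s` matter). -/
def MemHInfty (s : ℝ) (g : ℂ → ℂ) : Prop :=
  DifferentiableOn ℂ g (annulus s) ∧ ∃ M : ℝ, ∀ z ∈ annulus s, ‖g z‖ ≤ M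

/-- `f ∈ H^{k,∞}(G_s)`: the complex derivatives `f^{(j)}`, `0 ≤ j ≤ k`, are in `H^∞(G_s)`. -/
def MemHardySobolev (s : ℝ) (k : ℕ) (f : ℂ → ℂ) : Prop :=
  ∀ j ≤ k, MemHInfty s (iteratedDeriv j f)

/-- `‖g‖_{L^∞(r𝕋)}`, for `r = s` or `r = 1`: the essential supremum of the boundary values. -/
def linftyCircleNorm (s r : ℝ) (g : ℂ → ℂ) : ℝ≥0∞ :=
  eLpNorm (boundaryValue s g) ∞ (circleMeasure r)

/-- `‖f‖_{H^{k,∞}} = max_{0 ≤ j ≤ k} (‖f^{(j)}‖_{L^∞(s𝕋)} + ‖f^{(j)}‖_{L^∞(𝕋)})`. -/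
def hardySobolevNorm (s : ℝ) (k : ℕ) (f : ℂ → ℂ) : ℝ≥0∞ :=
  (Finset.range (k + 1)).sup fun j =>
    linftyCircleNorm s s (iteratedDeriv j f) + linftyCircleNorm s 1 (iteratedDeriv j f)

/-- The closed unit ball of `H^{k,∞}(∂G_s)`. -/
def hardySobolevUnitBall (s : ℝ) (k : ℕ) : Set (ℂ → ℂ) :=
  {f | MemHardySobolev s k f ∧ hardySobolevNorm s k f ≤ 1}

/-- `‖f‖_{L^1(I)} = μ(I)⁻¹ ∫_I |f| dμ`, the normalized `L^1` norm of the boundary values on `I`. -/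
def l1ArcNorm (s : ℝ) (I : Set ℂ) (f : ℂ → ℂ) : ℝ≥0∞ :=
  (boundaryMeasure s I)⁻¹ * ∫⁻ z in I, ‖boundaryValue s f z‖ₑ ∂(boundaryMeasure s)

/-- `I` is a (nonempty) connected, relatively open subset of `∂G_s`. -/
def IsOpenBoundaryArc (s : ℝ) (I : Set ℂ) : Prop :=
  IsConnected I ∧ ∃ U : Set ℂ, IsOpen U ∧ I = U ∩ annulusBoundary s

end

/-!
Composition with `exp` turns an analytic function `g` on the annulus into one on the vertical strip
`log s < re w < 0`, where a bounded derivative means Lipschitz, hence continuous up to the edges.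
Boundary values of `g` become values of the lift on the edges.

Both halves of the argument rest on one principle: if equi-Lipschitz functions, holomorphic on a
convex open set, tend to zero on a piece of its frontier, then they tend to zero inside. By
compactness this is a uniqueness statement for a single limit function `G`, which is proved by
applying the maximum principle to the product of `G` over the four quarter turns about a point near
the piece: on the frontier of the common domain of the four factors one of them vanishes.

Applied to blow-ups at an edge point, the principle shows that wherever the lift is differentiable
along the edge, the boundary value of its derivative is the tangential derivative divided by `i`. So
the `L^∞` norms of `g'` bound the Lipschitz constant of the lift on the edges, and by
Phragmén–Lindelöf its derivative inside: functions in the unit ball have equi-Lipschitz lifts.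
For these, convergence in `L^1(I)` gives pointwise convergence on `I`, and the principle gives
convergence in the annulus. Derivatives follow by Weierstrass's theorem, and up to the boundary all
convergence is uniform by equicontinuity.
-/

open Complex.HadamardThreeLines (verticalStrip verticalClosedStrip)

noncomputable section

/-! ### Equi-Lipschitz limits and unique continuation from the boundary -/

theorem tendstoUniformlyOn_of_equicontinuousOn {ι X α : Type*} [TopologicalSpace X]
    [UniformSpace α] {l : Filter ι} {F : ι → X → α} {f : X → α} {S : Set X} (hS : IsCompact S)
    (hF : EquicontinuousOn F S) (h : ∀ x ∈ S, Tendsto (F · x) l (𝓝 (f x))) :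
    TendstoUniformlyOn F f l S := by
  have hpi : Tendsto (UniformOnFun.ofFun {S} ∘ F) l (𝓝 (UniformOnFun.ofFun {S} f)) := by
    rw [EquicontinuousOn.tendsto_uniformOnFun_iff_pi' (by simpa using hS) (by simpa using hF),
      tendsto_pi_nhds]
    rintro ⟨x, hx⟩
    exact h x (by simpa using hx)
  exact UniformOnFun.tendsto_iff_tendstoUniformlyOn.1 hpi S rfl

theorem equicontinuous_of_lipschitzWith {ι X α : Type*} [PseudoEMetricSpace X]
    [PseudoEMetricSpace α] {F : ι → X → α} {K : NNReal} (hF : ∀ p, LipschitzWith K (F p)) :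
    Equicontinuous F :=
  (LipschitzWith.uniformEquicontinuous F K hF).equicontinuous

theorem tendstoLocallyUniformlyOn_of_lipschitzWith {ι X α : Type*} [PseudoEMetricSpace X]
    [LocallyCompactSpace X] [PseudoEMetricSpace α] {l : Filter ι} {F : ι → X → α} {f : X → α}
    {K : NNReal} {Ω : Set X} (hΩ : IsOpen Ω) (hF : ∀ p, LipschitzWith K (F p))
    (h : ∀ w ∈ Ω, Tendsto (F · w) l (𝓝 (f w))) : TendstoLocallyUniformlyOn F f l Ω :=
  (tendstoLocallyUniformlyOn_iff_forall_isCompact hΩ).2 fun _ hSΩ hS ↦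
    tendstoUniformlyOn_of_equicontinuousOn hS
      ((equicontinuous_of_lipschitzWith hF).equicontinuousOn _) fun x hx ↦ h x (hSΩ hx)

theorem tendsto_deriv_of_lipschitzWith {ι E : Type*} [NormedAddCommGroup E] [NormedSpace ℂ E]
    [CompleteSpace E] {l : Filter ι} {F : ι → ℂ → E} {f : ℂ → E} {K : NNReal} {Ω : Set ℂ}
    (hΩ : IsOpen Ω) (hF : ∀ p, LipschitzWith K (F p))
    (hd : ∀ᶠ p in l, DifferentiableOn ℂ (F p) Ω) (h : ∀ w ∈ Ω, Tendsto (F · w) l (𝓝 (f w)))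
    {w : ℂ} (hw : w ∈ Ω) : Tendsto (fun p ↦ deriv (F p) w) l (𝓝 (deriv f w)) :=
  ((tendstoLocallyUniformlyOn_of_lipschitzWith hΩ hF h).deriv hd hΩ).tendsto_at hw

theorem tendsto_zero_of_tendsto_setLIntegral {ι X E : Type*} [TopologicalSpace X]
    [MeasurableSpace X] [OpensMeasurableSpace X] [SeminormedAddCommGroup E] {μ : Measure X}
    {l : Filter ι} {h : ι → X → E} {S : Set X} (hS : MeasurableSet S) {x : X}
    (hx : x ∈ (μ.restrict S).support) (hh : EquicontinuousWithinAt h S x)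
    (hint : Tendsto (fun p ↦ ∫⁻ y in S, ‖h p y‖ₑ ∂μ) l (𝓝 0)) :
    Tendsto (h · x) l (𝓝 0) := by
  refine NormedAddGroup.tendsto_nhds_zero.2 fun ε hε ↦ ?_
  obtain ⟨V, hV, hxV, hVS⟩ := mem_nhdsWithin.1
    (hh _ (Metric.dist_mem_uniformity (half_pos hε)))
  have hpos : 0 < μ (V ∩ S) := by
    rw [← Measure.restrict_apply hV.measurableSet]
    exact (Measure.mem_support_iff_forall x).1 hx V (hV.mem_nhds hxV)
  have hc : 0 < ENNReal.ofReal (ε / 2) * μ (V ∩ S) :=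
    ENNReal.mul_pos (by simpa using hε) hpos.ne'
  filter_upwards [hint.eventually_lt_const hc] with p hp
  by_contra! hεp
  refine hp.not_ge ?_
  calc ENNReal.ofReal (ε / 2) * μ (V ∩ S) = ∫⁻ _ in V ∩ S, ENNReal.ofReal (ε / 2) ∂μ := by simp
    _ ≤ ∫⁻ y in V ∩ S, ‖h p y‖ₑ ∂μ := by
      refine setLIntegral_mono' (hV.measurableSet.inter hS) fun y hy ↦ ?_
      rw [← ofReal_norm]
      have hxy : dist (h p x) (h p y) < ε / 2 := hVS hy p
      refine ENNReal.ofReal_le_ofReal ?_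
      linarith [norm_sub_norm_le (h p x) (h p y), dist_eq_norm (h p x) (h p y)]
    _ ≤ ∫⁻ y in S, ‖h p y‖ₑ ∂μ := lintegral_mono_set Set.inter_subset_right

theorem lipschitzWith_of_ae_norm_deriv_le {E : Type*} [NormedAddCommGroup E] [NormedSpace ℝ E]
    [FiniteDimensional ℝ E] {φ : ℝ → E} {K C : NNReal} (hφ : LipschitzWith K φ)
    (hC : ∀ᵐ t : ℝ, ‖deriv φ t‖ ≤ C) : LipschitzWith C φ := by
  refine lipschitzWith_iff_norm_sub_le.2 fun x y ↦ ?_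
  obtain ⟨L, hL, hLxy⟩ := exists_dual_vector'' ℝ (φ x - φ y)
  have hlip : LipschitzWith (‖L‖₊ * K) (L ∘ φ) := L.lipschitz.comp hφ
  have hderiv : ∀ᵐ t : ℝ, ‖deriv (L ∘ φ) t‖ ≤ C := by
    filter_upwards [hφ.ae_differentiableAt_real, hC] with t ht hCt
    rw [(L.hasFDerivAt.comp_hasDerivAt t ht.hasDerivAt).deriv]
    exact ((L.le_of_opNorm_le hL _).trans_eq (one_mul _)).trans hCt
  calc ‖φ x - φ y‖ = (L ∘ φ) x - (L ∘ φ) y := by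
        rw [Function.comp_apply, Function.comp_apply, ← map_sub, hLxy]; rfl
    _ = ∫ t in y..x, deriv (L ∘ φ) t :=
        (AbsolutelyContinuousOnInterval.integral_deriv_eq_sub
          hlip.lipschitzOnWith.absolutelyContinuousOnInterval).symm
    _ ≤ C * |x - y| := (Real.le_norm_self _).trans
        (intervalIntegral.norm_integral_le_of_norm_le_const_ae (hderiv.mono fun _ h _ ↦ h))

theorem norm_le_two_mul_norm_of_rotations {f : ℂ →L[ℝ] ℝ} (hf : f ≠ 0) {u v : ℂ}
    (h : ∀ k : Fin 4, f (Complex.I ^ (k : ℕ) * u) ≤ f v) : ‖u‖ ≤ 2 * ‖v‖ := by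
  have hcoord (z : ℂ) : f z = z.re * f 1 + z.im * f Complex.I := by
    conv_lhs => rw [← Complex.re_add_im z]
    rw [map_add, ← Complex.real_smul, map_smul, smul_eq_mul, ← mul_one (z.re : ℂ),
      ← Complex.real_smul, map_smul, smul_eq_mul]
  have hpos : 0 < f 1 ^ 2 + f Complex.I ^ 2 := by
    contrapose! hf
    ext z
    have h1 : f 1 = 0 := by nlinarith [sq_nonneg (f 1), sq_nonneg (f Complex.I)]
    have hI : f Complex.I = 0 := by nlinarith [sq_nonneg (f 1), sq_nonneg (f Complex.I)]
    simp [hcoord z, h1, hI]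
  have hk (k : Fin 4) := (hcoord _).symm.trans_le (h k)
  have h0 : u.re * f 1 + u.im * f Complex.I ≤ f v := by simpa using hk 0
  have h1 : -u.im * f 1 + u.re * f Complex.I ≤ f v := by simpa using hk 1
  have h2 : -u.re * f 1 + -u.im * f Complex.I ≤ f v := by simpa [pow_succ] using hk 2
  have h3 : u.im * f 1 + -u.re * f Complex.I ≤ f v := by simpa [pow_succ] using hk 3
  have hu : f v ^ 2 * 2 ≥ ‖u‖ ^ 2 * (f 1 ^ 2 + f Complex.I ^ 2) := by
    rw [Complex.sq_norm, Complex.normSq_apply]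
    nlinarith
  have hv : f v ^ 2 ≤ ‖v‖ ^ 2 * (f 1 ^ 2 + f Complex.I ^ 2) := by
    rw [Complex.sq_norm, Complex.normSq_apply, hcoord v]
    nlinarith [sq_nonneg (v.re * f Complex.I - v.im * f 1)]
  refine abs_le_of_sq_le_sq' ?_ (by positivity) |>.2
  nlinarith [sq_nonneg ‖v‖]

/-- The points `u` for which all four quarter turns `c + i ^ k * u` about `c` lie in `Ω`. It is
bounded whenever `Ω` lies in a half-plane, even if `Ω` itself is unbounded. -/
def quarterTurnCore (c : ℂ) (Ω : Set ℂ) : Set ℂ :=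
  ⋂ k : Fin 4, (fun u ↦ c + Complex.I ^ (k : ℕ) * u) ⁻¹' Ω

theorem continuous_quarterTurn (c : ℂ) (k : Fin 4) :
    Continuous fun u : ℂ ↦ c + Complex.I ^ (k : ℕ) * u := by
  fun_prop

theorem isOpen_quarterTurnCore (c : ℂ) {Ω : Set ℂ} (hΩ : IsOpen Ω) :
    IsOpen (quarterTurnCore c Ω) :=
  isOpen_iInter_of_finite fun k ↦ hΩ.preimage (continuous_quarterTurn c k)

theorem quarterTurn_mem_closure {c u : ℂ} {Ω : Set ℂ} (hu : u ∈ closure (quarterTurnCore c Ω))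
    (k : Fin 4) : c + Complex.I ^ (k : ℕ) * u ∈ closure Ω :=
  map_mem_closure (f := fun u ↦ c + Complex.I ^ (k : ℕ) * u) (continuous_quarterTurn c k) hu
    fun _ hv ↦ Set.mem_iInter.1 hv k

theorem exists_quarterTurn_mem_frontier {c u : ℂ} {Ω : Set ℂ} (hΩ : IsOpen Ω)
    (hu : u ∈ frontier (quarterTurnCore c Ω)) :
    ∃ k : Fin 4, c + Complex.I ^ (k : ℕ) * u ∈ frontier Ω := by
  rw [(isOpen_quarterTurnCore c hΩ).frontier_eq] at hu
  obtain ⟨k, hk⟩ := not_forall.1 (mt Set.mem_iInter.2 hu.2)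
  exact ⟨k, hΩ.frontier_eq ▸ ⟨quarterTurn_mem_closure hu.1 k, hk⟩⟩

theorem norm_le_of_mem_closure_quarterTurnCore {c u w₀ : ℂ} {Ω : Set ℂ} {f : ℂ →L[ℝ] ℝ}
    (hf0 : f ≠ 0) (hf : ∀ w ∈ Ω, f w ≤ f w₀) (hu : u ∈ closure (quarterTurnCore c Ω)) :
    ‖u‖ ≤ 2 * dist c w₀ := by
  rw [dist_comm, dist_eq_norm]
  refine norm_le_two_mul_norm_of_rotations hf0 fun k ↦ ?_
  have hfk : f (c + Complex.I ^ (k : ℕ) * u) ≤ f w₀ :=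
    closure_minimal hf (isClosed_le f.continuous continuous_const) (quarterTurn_mem_closure hu k)
  rw [map_add] at hfk
  rw [map_sub]
  linarith

theorem diffContOnCl_prod_quarterTurn {G : ℂ → ℂ} {Ω : Set ℂ} (hG : DiffContOnCl ℂ G Ω) (c : ℂ) :
    DiffContOnCl ℂ (fun u ↦ ∏ k : Fin 4, G (c + Complex.I ^ (k : ℕ) * u))
      (quarterTurnCore c Ω) where
  differentiableOn := DifferentiableOn.fun_finsetProd fun k _ ↦
    hG.differentiableOn.comp (by fun_prop) fun _ hu ↦ Set.mem_iInter.1 hu k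
  continuousOn := continuousOn_finsetProd _ fun k _ ↦
    hG.continuousOn.comp (continuous_quarterTurn c k).continuousOn fun _ hu ↦
      quarterTurn_mem_closure hu k

theorem eq_zero_of_frontier_eq_zero_near {G : ℂ → ℂ} {Ω : Set ℂ} (hΩ : IsOpen Ω)
    (hG : DiffContOnCl ℂ G Ω) {f : ℂ →L[ℝ] ℝ} {w₀ c : ℂ} (hf : ∀ w ∈ Ω, f w < f w₀) (hc : c ∈ Ω)
    (h0 : ∀ w ∈ frontier Ω, dist w w₀ ≤ 3 * dist c w₀ → G w = 0) : G c = 0 := by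
  have hf0 : f ≠ 0 := by
    rintro rfl
    simpa using hf c hc
  have hbound {u : ℂ} (hu : u ∈ closure (quarterTurnCore c Ω)) : ‖u‖ ≤ 2 * dist c w₀ :=
    norm_le_of_mem_closure_quarterTurnCore hf0 (fun w hw ↦ (hf w hw).le) hu
  have hfrontier (u : ℂ) (hu : u ∈ frontier (quarterTurnCore c Ω)) :
      ‖∏ k : Fin 4, G (c + Complex.I ^ (k : ℕ) * u)‖ ≤ 0 := by
    obtain ⟨k, hk⟩ := exists_quarterTurn_mem_frontier hΩ hu
    refine norm_le_zero_iff.2 (Finset.prod_eq_zero (Finset.mem_univ k) (h0 _ hk ?_))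
    calc dist (c + Complex.I ^ (k : ℕ) * u) w₀
        ≤ dist (c + Complex.I ^ (k : ℕ) * u) c + dist c w₀ := dist_triangle _ _ _
      _ = ‖u‖ + dist c w₀ := by simp
      _ ≤ 3 * dist c w₀ := by linarith [hbound (frontier_subset_closure hu)]
  have hzero : ‖∏ k : Fin 4, G (c + Complex.I ^ (k : ℕ) * 0)‖ ≤ 0 :=
    Complex.norm_le_of_forall_mem_frontier_norm_le
      (isBounded_iff_forall_norm_le.2 ⟨_, fun _ hu ↦ hbound (subset_closure hu)⟩)
      (diffContOnCl_prod_quarterTurn hG c) hfrontier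
      (subset_closure (Set.mem_iInter.2 fun k ↦ by simpa using hc))
  simpa using norm_le_zero_iff.1 hzero

theorem eqOn_zero_of_eventually_frontier_eq_zero {G : ℂ → ℂ} {Ω : Set ℂ} (hΩ : IsOpen Ω)
    (hconv : Convex ℝ Ω) (hG : DiffContOnCl ℂ G Ω) {w₀ : ℂ} (hw₀ : w₀ ∈ frontier Ω)
    (h0 : ∀ᶠ w in 𝓝[frontier Ω] w₀, G w = 0) : Set.EqOn G 0 Ω := by
  rw [hΩ.frontier_eq] at hw₀
  obtain ⟨f, hf⟩ := geometric_hahn_banach_open_point hconv hΩ hw₀.2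
  obtain ⟨δ, hδ, hball⟩ := Metric.eventually_nhds_iff.1 (eventually_nhdsWithin_iff.1 h0)
  have hnear : ∀ c ∈ Ω, dist c w₀ < δ / 3 → G c = 0 := fun c hc hcw ↦
    eq_zero_of_frontier_eq_zero_near hΩ hG hf hc fun w hw hw' ↦ hball (by linarith) hw
  obtain ⟨c, hc, hcw⟩ := Metric.mem_closure_iff.1 hw₀.1 (δ / 3) (by positivity)
  rw [dist_comm] at hcw
  refine (hG.differentiableOn.analyticOnNhd hΩ).eqOn_zero_of_preconnected_of_eventuallyEq_zero
    hconv.isPreconnected hc ?_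
  filter_upwards [hΩ.mem_nhds hc, Metric.isOpen_ball.mem_nhds hcw] with v hv hvw
  exact hnear v hv hvw

theorem exists_lipschitzWith_tendsto_ultrafilter {ι X E : Type*} [PseudoMetricSpace X]
    [PseudoMetricSpace E] [ProperSpace E] {U : Ultrafilter ι} {F : ι → X → E} {K : NNReal}
    (hF : ∀ p, LipschitzWith K (F p)) {x₀ : X} {a : E} (ha : Tendsto (F · x₀) U (𝓝 a)) :
    ∃ G, LipschitzWith K G ∧ ∀ x, Tendsto (F · x) U (𝓝 (G x)) := by
  have hlim (x : X) : ∃ b, Tendsto (F · x) U (𝓝 b) := by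
    have hball : ∀ᶠ p in (U : Filter ι), F p x ∈ Metric.closedBall a (1 + K * dist x x₀) := by
      filter_upwards [ha.eventually_mem (Metric.closedBall_mem_nhds a one_pos)] with p hp
      rw [Metric.mem_closedBall] at hp ⊢
      linarith [dist_triangle (F p x) (F p x₀) a, (hF p).dist_le_mul x x₀]
    obtain ⟨b, -, hb⟩ := (isCompact_closedBall a (1 + K * dist x x₀)).ultrafilter_le_nhds
      (U.map (F · x)) (le_principal_iff.2 hball)
    exact ⟨b, hb⟩
  choose G hG using hlim
  exact ⟨G, .of_dist_le_mul fun x y ↦ le_of_tendsto ((hG x).dist (hG y))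
    (.of_forall fun p ↦ (hF p).dist_le_mul x y), hG⟩

theorem tendsto_zero_of_tendsto_zero_frontier {ι : Type*} {l : Filter ι} {F : ι → ℂ → ℂ}
    {K : NNReal} {Ω : Set ℂ} (hΩ : IsOpen Ω) (hconv : Convex ℝ Ω)
    (hF : ∀ p, LipschitzWith K (F p)) (hd : ∀ᶠ p in l, DifferentiableOn ℂ (F p) Ω) {w₀ : ℂ}
    (hw₀ : w₀ ∈ frontier Ω) (h0 : ∀ᶠ w in 𝓝[frontier Ω] w₀, Tendsto (F · w) l (𝓝 0)) {w : ℂ}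
    (hw : w ∈ Ω) : Tendsto (F · w) l (𝓝 0) := by
  refine (tendsto_iff_ultrafilter _ _ _).2 fun U hU ↦ ?_
  obtain ⟨G, hGK, hG⟩ := exists_lipschitzWith_tendsto_ultrafilter hF
    ((h0.self_of_nhdsWithin hw₀).mono_left hU)
  have hGd : DifferentiableOn ℂ G Ω :=
    (tendstoLocallyUniformlyOn_of_lipschitzWith hΩ hF fun v _ ↦ hG v).differentiableOn
      (hd.filter_mono hU) hΩ
  have hG0 : Set.EqOn G 0 Ω :=
    eqOn_zero_of_eventually_frontier_eq_zero hΩ hconv ⟨hGd, hGK.continuous.continuousOn⟩ hw₀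
      (h0.mono fun v hv ↦ tendsto_nhds_unique (hG v) (hv.mono_left hU))
  simpa only [hG0 hw, Pi.zero_apply] using hG w

/-! ### Blow-up at the edge of a strip -/

/-- The blow-up of `G` at `w` with scale `r`, minus the linear map of slope `m`: it tends to zero
as `r → 0` when `m` is the derivative of `G` at `w`. -/
def blowUp (G : ℂ → ℂ) (w m : ℂ) (r : ℝ) (z : ℂ) : ℂ :=
  (r : ℂ)⁻¹ * (G (w + r * z) - G w) - m * z

theorem lipschitzWith_blowUp {G : ℂ → ℂ} {K : NNReal} (hG : LipschitzWith K G) (w m : ℂ) (r : ℝ) :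
    LipschitzWith (K + ‖m‖₊) (blowUp G w m r) := by
  refine lipschitzWith_iff_norm_sub_le.2 fun x y ↦ ?_
  have hr : ‖(r : ℂ)⁻¹‖ * ‖(r : ℂ)‖ ≤ 1 := by
    rw [norm_inv]
    exact inv_mul_le_one
  have hGr : ‖G (w + r * x) - G (w + r * y)‖ ≤ K * (‖(r : ℂ)‖ * ‖x - y‖) := by
    simpa only [add_sub_add_left_eq_sub, ← mul_sub, norm_mul] using
      hG.norm_sub_le (w + r * x) (w + r * y)
  calc ‖blowUp G w m r x - blowUp G w m r y‖
      = ‖(r : ℂ)⁻¹ * (G (w + r * x) - G (w + r * y)) - m * (x - y)‖ := by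
        congr 1; simp only [blowUp]; ring
    _ ≤ ‖(r : ℂ)⁻¹‖ * (K * (‖(r : ℂ)‖ * ‖x - y‖)) + ‖m‖ * ‖x - y‖ := by
        refine (norm_sub_le _ _).trans ?_
        rw [norm_mul, norm_mul]
        gcongr
    _ ≤ (K + ‖m‖₊ : NNReal) * ‖x - y‖ := by
        rw [NNReal.coe_add, coe_nnnorm, add_mul]
        gcongr ?_ + _
        nlinarith [mul_nonneg K.coe_nonneg (norm_nonneg (x - y))]

theorem hasDerivAt_blowUp {G : ℂ → ℂ} {w z : ℂ} (m : ℂ) {r : ℝ} (hr : r ≠ 0)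
    (hG : DifferentiableAt ℂ G (w + r * z)) :
    HasDerivAt (blowUp G w m r) (deriv G (w + r * z) - m) z := by
  have hinner : HasDerivAt (fun z ↦ w + r * z) (r : ℂ) z := by
    simpa using ((hasDerivAt_id z).const_mul (r : ℂ)).const_add w
  have h := ((hG.hasDerivAt.comp z hinner).sub_const (G w)).const_mul (r : ℂ)⁻¹
    |>.sub ((hasDerivAt_id z).const_mul m)
  rwa [mul_one, mul_left_comm, inv_mul_cancel₀ (by exact_mod_cast hr), mul_one] at h

theorem tendsto_blowUp_mul_I {G : ℂ → ℂ} {w d : ℂ}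
    (hd : HasDerivAt (fun t : ℝ ↦ G (w.re + t * Complex.I)) d w.im) (t : ℝ) :
    Tendsto (fun r : ℝ ↦ blowUp G w (-Complex.I * d) r (t * Complex.I)) (𝓝[≠] 0) (𝓝 0) := by
  have hline : HasDerivAt (fun r : ℝ ↦ G (w + r * (t * Complex.I))) (t * d) 0 := by
    have hinner : HasDerivAt (fun r : ℝ ↦ w.im + r * t) t 0 := by
      simpa using ((hasDerivAt_id (0 : ℝ)).mul_const t).const_add w.im
    have h := HasDerivAt.scomp_of_eq (0 : ℝ) hd hinner (by simp)
    rw [Complex.real_smul] at h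
    refine h.congr_of_eventuallyEq (.of_forall fun r ↦ congrArg G ?_)
    conv_lhs => rw [← Complex.re_add_im w]
    push_cast
    ring
  have hslope := (hasDerivAt_iff_tendsto_slope_zero.1 hline).sub_const (t * d)
  rw [sub_self] at hslope
  refine hslope.congr fun r ↦ ?_
  rw [blowUp, Complex.real_smul, zero_add, Complex.ofReal_zero, zero_mul, add_zero,
    Complex.ofReal_inv]
  linear_combination (-d * t) * Complex.I_sq

theorem isOpen_verticalStrip (a b : ℝ) : IsOpen (verticalStrip a b) :=
  isOpen_Ioo.preimage Complex.continuous_re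

theorem convex_verticalStrip (a b : ℝ) : Convex ℝ (verticalStrip a b) :=
  (convex_Ioo a b).linear_preimage Complex.reLm

theorem closure_verticalStrip {a b : ℝ} (hab : a < b) :
    closure (verticalStrip a b) = verticalClosedStrip a b := by
  rw [verticalStrip, Complex.closure_preimage_re, closure_Ioo hab.ne, verticalClosedStrip]

theorem frontier_verticalStrip {a b : ℝ} (hab : a < b) :
    frontier (verticalStrip a b) = Complex.re ⁻¹' {a, b} := by
  rw [verticalStrip, Complex.frontier_preimage_re, frontier_Ioo hab]

theorem eventually_differentiableOn_blowUp {G : ℂ → ℂ} {a b : ℝ} (hab : a < b)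
    (hd : DifferentiableOn ℂ G (verticalStrip a b)) {w : ℂ}
    (hw : w ∈ frontier (verticalStrip a b)) (m : ℂ) :
    ∀ᶠ r : ℝ in 𝓝[{r | w + r ∈ verticalStrip a b}] 0,
      DifferentiableOn ℂ (blowUp G w m r) (verticalStrip 0 2) := by
  rw [frontier_verticalStrip hab] at hw
  filter_upwards [self_mem_nhdsWithin, mem_nhdsWithin_of_mem_nhds
    (Metric.ball_mem_nhds (0 : ℝ) (half_pos (sub_pos.2 hab)))] with r hr hball z hz
  rw [Metric.mem_ball, dist_zero_right, Real.norm_eq_abs, abs_lt] at hball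
  have hr' : w.re + r ∈ Set.Ioo a b := by simpa [verticalStrip] using hr
  have hr0 : r ≠ 0 := by
    rintro rfl
    rcases hw with hw | hw <;> simp_all
  have hmem : w + r * z ∈ verticalStrip a b := by
    have hre : (w + r * z).re = w.re + r * z.re := by simp
    rw [verticalStrip, Set.mem_preimage, hre]
    obtain ⟨hz0, hz2⟩ := hz
    rcases hw with hw | hw
    all_goals
      rw [hw] at hr' ⊢
      constructor <;> nlinarith [hr'.1, hr'.2]
  exact (hasDerivAt_blowUp m hr0 (hd.differentiableAt
    ((isOpen_verticalStrip a b).mem_nhds hmem))).differentiableAt.differentiableWithinAt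

theorem tendsto_deriv_of_hasDerivAt_frontier {G : ℂ → ℂ} {K : NNReal} (hG : LipschitzWith K G)
    {a b : ℝ} (hab : a < b) (hd : DifferentiableOn ℂ G (verticalStrip a b)) {w d : ℂ}
    (hw : w ∈ frontier (verticalStrip a b))
    (hderiv : HasDerivAt (fun t : ℝ ↦ G (w.re + t * Complex.I)) d w.im) :
    Tendsto (fun r : ℝ ↦ deriv G (w + r)) (𝓝[{r | w + r ∈ verticalStrip a b}] 0)
      (𝓝 (-Complex.I * d)) := by
  set m : ℂ := -Complex.I * d
  have hne (r : ℝ) (hr : w + r ∈ verticalStrip a b) : r ≠ 0 := by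
    rintro rfl
    rw [(isOpen_verticalStrip a b).frontier_eq] at hw
    exact hw.2 (by simpa using hr)
  have hfrontier : ∀ᶠ z in 𝓝[frontier (verticalStrip 0 2)] 0, Tendsto (fun r ↦ blowUp G w m r z)
      (𝓝[{r | w + r ∈ verticalStrip a b}] 0) (𝓝 0) := by
    rw [frontier_verticalStrip two_pos]
    filter_upwards [self_mem_nhdsWithin, mem_nhdsWithin_of_mem_nhds
      (Complex.continuous_re.continuousAt.eventually_lt_const two_pos)] with z hz hz2
    have hz0 : z.re = 0 := Or.resolve_right hz hz2.ne
    have hzI : z = z.im * Complex.I := by simpa [hz0] using (Complex.re_add_im z).symm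
    rw [hzI]
    exact (tendsto_blowUp_mul_I hderiv z.im).mono_left (nhdsWithin_mono 0 hne)
  have hdiff := eventually_differentiableOn_blowUp hab hd hw m
  have hlim : Tendsto (fun r : ℝ ↦ deriv (blowUp G w m r) 1)
      (𝓝[{r | w + r ∈ verticalStrip a b}] 0) (𝓝 (deriv (fun _ : ℂ ↦ (0 : ℂ)) 1)) :=
    tendsto_deriv_of_lipschitzWith (isOpen_verticalStrip 0 2) (lipschitzWith_blowUp hG w m) hdiff
      (fun z hz ↦ tendsto_zero_of_tendsto_zero_frontier (isOpen_verticalStrip 0 2)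
        (convex_verticalStrip 0 2) (lipschitzWith_blowUp hG w m) hdiff
        (by simp [frontier_verticalStrip]) hfrontier hz)
      (by norm_num [verticalStrip])
  rw [deriv_const] at hlim
  refine tendsto_sub_nhds_zero_iff.1 (hlim.congr' ?_)
  filter_upwards [self_mem_nhdsWithin] with r hr
  have hr1 : w + r * 1 ∈ verticalStrip a b := by rwa [mul_one]
  rw [(hasDerivAt_blowUp m (hne r hr)
    (hd.differentiableAt ((isOpen_verticalStrip a b).mem_nhds hr1))).deriv, mul_one]

theorem lipschitzWith_vertical_line {E : Type*} [NormedAddCommGroup E] [NormedSpace ℂ E]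
    {G : ℂ → E} {K C : NNReal} (hG : LipschitzWith K G) {a b : ℝ}
    (hd : DifferentiableOn ℂ G (verticalStrip a b))
    (ha : LipschitzWith C fun t : ℝ ↦ G (a + t * Complex.I))
    (hb : LipschitzWith C fun t : ℝ ↦ G (b + t * Complex.I)) {x : ℝ} (hx : x ∈ Set.Ioo a b) :
    LipschitzWith C fun t : ℝ ↦ G (x + t * Complex.I) := by
  refine lipschitzWith_iff_norm_sub_le.2 fun t u ↦ ?_
  set h : ℝ := t - u with hh
  have hedge {c : ℝ} (hc : LipschitzWith C fun t : ℝ ↦ G (c + t * Complex.I)) (z : ℂ)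
      (hz : z.re = c) : ‖G (z + h * Complex.I) - G z‖ ≤ C * ‖h‖ := by
    have hshift : z + h * Complex.I = c + (z.im + h : ℝ) * Complex.I := by
      conv_lhs => rw [← Complex.re_add_im z, hz]
      push_cast
      ring
    simpa only [hshift, ← hz, Complex.re_add_im, add_sub_cancel_left] using
      hc.norm_sub_le (z.im + h) z.im
  have hdiff : DifferentiableOn ℂ (fun z ↦ G (z + h * Complex.I) - G z) (verticalStrip a b) :=
    (hd.comp (by fun_prop) fun z hz ↦ by simpa [verticalStrip] using hz).sub hd
  have hbdd : (fun z ↦ G (z + h * Complex.I) - G z) =O[comap (abs ∘ Complex.im) atTop ⊓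
      𝓟 (verticalStrip a b)] fun z ↦ Real.exp (0 * Real.exp (0 * |z.im|)) := by
    refine .of_bound (K * ‖h‖) (.of_forall fun z ↦ ?_)
    simpa using hG.norm_sub_le (z + h * Complex.I) z
  have hPL := PhragmenLindelof.vertical_strip (z := x + u * Complex.I)
    ⟨hdiff, (hG.continuous.comp (continuous_add_const _) |>.sub hG.continuous).continuousOn⟩
    ⟨0, div_pos Real.pi_pos (sub_pos.2 (hx.1.trans hx.2)), 0, hbdd⟩ (hedge ha) (hedge hb)
    (by simpa using hx.1.le) (by simpa using hx.2.le)
  rwa [hh, add_assoc, ← add_mul, ← Complex.ofReal_add, add_sub_cancel] at hPL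

theorem norm_deriv_le_of_lipschitzWith_edges {E : Type*} [NormedAddCommGroup E] [NormedSpace ℂ E]
    {G : ℂ → E} {K C : NNReal} (hG : LipschitzWith K G)
    {a b : ℝ} (hd : DifferentiableOn ℂ G (verticalStrip a b))
    (ha : LipschitzWith C fun t : ℝ ↦ G (a + t * Complex.I))
    (hb : LipschitzWith C fun t : ℝ ↦ G (b + t * Complex.I)) {w : ℂ}
    (hw : w ∈ verticalStrip a b) : ‖deriv G w‖ ≤ C := by
  have hGw : HasDerivAt G (deriv G w) (w.re + w.im * Complex.I) := by
    rw [Complex.re_add_im]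
    exact (hd.differentiableAt ((isOpen_verticalStrip a b).mem_nhds hw)).hasDerivAt
  have hline : HasDerivAt (fun t : ℝ ↦ (w.re : ℂ) + t * Complex.I) Complex.I w.im := by
    simpa using ((Complex.ofRealCLM.hasDerivAt (x := w.im)).mul_const Complex.I).const_add
      (w.re : ℂ)
  calc ‖deriv G w‖ = ‖deriv (G ∘ fun t : ℝ ↦ (w.re : ℂ) + t * Complex.I) w.im‖ := by
        rw [(hGw.scomp w.im hline).deriv, norm_smul, Complex.norm_I, one_mul]
    _ ≤ C := norm_deriv_le_of_lipschitz (lipschitzWith_vertical_line hG hd ha hb hw)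

/-! ### Lifting to the logarithmic strip -/

/-- The vertical strip `log s < re w < 0`, which `exp` maps onto the annulus `G_s` as a covering. -/
abbrev logStrip (s : ℝ) : Set ℂ := verticalStrip (Real.log s) 0

theorem exp_mem_annulus_iff {s : ℝ} (hs0 : 0 < s) {w : ℂ} :
    Complex.exp w ∈ annulus s ↔ w ∈ logStrip s := by
  rw [annulus, Set.mem_ofPred_eq, Complex.norm_exp, ← Real.log_lt_iff_lt_exp hs0,
    Real.exp_lt_one_iff]
  rfl

theorem exp_log_of_mem_annulus {s : ℝ} (hs0 : 0 < s) {z : ℂ} (hz : z ∈ annulus s) :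
    Complex.exp (Complex.log z) = z :=
  Complex.exp_log (norm_pos_iff.1 (hs0.trans hz.1))

theorem log_mem_logStrip {s : ℝ} (hs0 : 0 < s) {z : ℂ} (hz : z ∈ annulus s) :
    Complex.log z ∈ logStrip s := by
  rwa [← exp_mem_annulus_iff hs0, exp_log_of_mem_annulus hs0 hz]

theorem frontier_logStrip {s : ℝ} (hs0 : 0 < s) (hs1 : s < 1) :
    frontier (logStrip s) = Complex.exp ⁻¹' annulusBoundary s := by
  rw [frontier_verticalStrip (Real.log_neg hs0 hs1)]
  ext w
  rw [Set.mem_preimage, Set.mem_preimage, annulusBoundary, Set.mem_union,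
    mem_sphere_zero_iff_norm, mem_sphere_zero_iff_norm, Complex.norm_exp, Real.exp_eq_one_iff,
    Set.mem_insert_iff, Set.mem_singleton_iff, ← Real.exp_eq_exp (y := Real.log s),
    Real.exp_log hs0]

theorem ne_zero_of_mem_annulusBoundary {s : ℝ} (hs0 : 0 < s) {z : ℂ}
    (hz : z ∈ annulusBoundary s) : z ≠ 0 := by
  rintro rfl
  simp [annulusBoundary, hs0.ne] at hz

theorem hasDerivAt_comp_exp {s : ℝ} (hs0 : 0 < s) {g : ℂ → ℂ}
    (hg : DifferentiableOn ℂ g (annulus s)) {w : ℂ} (hw : w ∈ logStrip s) :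
    HasDerivAt (g ∘ Complex.exp) (deriv g (Complex.exp w) * Complex.exp w) w := by
  have hopen : IsOpen (annulus s) :=
    (isOpen_lt continuous_const continuous_norm).inter (isOpen_lt continuous_norm continuous_const)
  exact (hg.differentiableAt (hopen.mem_nhds ((exp_mem_annulus_iff hs0).2 hw))).hasDerivAt.comp w
    (Complex.hasDerivAt_exp w)

/-- `F` is a `K`-Lipschitz function on the plane that agrees with `g ∘ exp` on the logarithmic strip
of the annulus `G_s`. The values of `F` on the boundary of the strip then encode the boundary values
of `g`. -/
structure IsLipschitzStripLift (s : ℝ) (K : NNReal) (g F : ℂ → ℂ) : Prop where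
  lipschitz : LipschitzWith K F
  eqOn : Set.EqOn F (g ∘ Complex.exp) (logStrip s)

theorem exists_isLipschitzStripLift_of_norm_deriv_le {s : ℝ} (hs0 : 0 < s) {g : ℂ → ℂ}
    (hg : DifferentiableOn ℂ g (annulus s)) {M : NNReal}
    (hM : ∀ w ∈ logStrip s, ‖deriv (g ∘ Complex.exp) w‖ ≤ M) :
    ∃ F, IsLipschitzStripLift s (lipschitzExtensionConstant ℂ * M) g F := by
  obtain ⟨F, hF, hE⟩ := ((convex_verticalStrip _ _).lipschitzOnWith_of_nnnorm_deriv_le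
    (fun w hw ↦ (hasDerivAt_comp_exp hs0 hg hw).differentiableAt) hM).extend_finite_dimension
  exact ⟨F, hF, hE.symm⟩

namespace IsLipschitzStripLift

variable {s : ℝ} {K : NNReal} {g F : ℂ → ℂ}

theorem hasDerivAt (hF : IsLipschitzStripLift s K g F) (hs0 : 0 < s)
    (hg : DifferentiableOn ℂ g (annulus s)) {w : ℂ} (hw : w ∈ logStrip s) :
    HasDerivAt F (deriv g (Complex.exp w) * Complex.exp w) w :=
  (hasDerivAt_comp_exp hs0 hg hw).congr_of_eventuallyEq
    (hF.eqOn.eventuallyEq_of_mem ((isOpen_verticalStrip _ _).mem_nhds hw))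

theorem differentiableOn (hF : IsLipschitzStripLift s K g F) (hs0 : 0 < s)
    (hg : DifferentiableOn ℂ g (annulus s)) : DifferentiableOn ℂ F (logStrip s) :=
  fun _ hw ↦ (hF.hasDerivAt hs0 hg hw).differentiableAt.differentiableWithinAt

end IsLipschitzStripLift

theorem boundaryValue_exp_eq_of_tendsto {s : ℝ} (hs0 : 0 < s) (hs1 : s < 1) {g : ℂ → ℂ}
    {w ℓ : ℂ} (hw : w ∈ frontier (logStrip s))
    (h : Tendsto (fun r : ℝ ↦ g (Complex.exp (w + r))) (𝓝[{r | w + r ∈ logStrip s}] 0) (𝓝 ℓ)) :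
    boundaryValue s g (Complex.exp w) = ℓ := by
  have hnorm : ‖Complex.exp w‖ = Real.exp w.re := Complex.norm_exp w
  have hclosure : ‖Complex.exp w‖ ∈ closure (Set.Ioo s 1) := by
    rw [frontier_logStrip hs0 hs1] at hw
    rw [closure_Ioo hs1.ne]
    rcases hw with hw | hw <;> rw [mem_sphere_zero_iff_norm.1 hw]
    exacts [Set.left_mem_Icc.2 hs1.le, Set.right_mem_Icc.2 hs1.le]
  have : (𝓝[Set.Ioo s 1] ‖Complex.exp w‖).NeBot := mem_closure_iff_nhdsWithin_neBot.1 hclosure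
  have hlog : Tendsto (fun ρ ↦ Real.log ρ - w.re) (𝓝[Set.Ioo s 1] ‖Complex.exp w‖)
      (𝓝[{r : ℝ | w + r ∈ logStrip s}] 0) := by
    refine tendsto_nhdsWithin_iff.2 ⟨?_, ?_⟩
    · have hlim := (Real.continuousAt_log (norm_ne_zero_iff.2
        (Complex.exp_ne_zero w))).tendsto.sub_const w.re
      rw [hnorm, Real.log_exp, sub_self, ← hnorm] at hlim
      exact hlim.mono_left nhdsWithin_le_nhds
    · filter_upwards [self_mem_nhdsWithin] with ρ hρ
      simpa [verticalStrip] using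
        And.intro (Real.log_lt_log hs0 hρ.1) (Real.log_neg (hs0.trans hρ.1) hρ.2)
  refine Tendsto.limUnder_eq ((h.comp hlog).congr' ?_)
  filter_upwards [self_mem_nhdsWithin] with ρ hρ
  rw [Function.comp_apply, Complex.exp_add, Complex.ofReal_sub, Complex.exp_sub,
    ← Complex.ofReal_exp, ← Complex.ofReal_exp, Real.exp_log (hs0.trans hρ.1), hnorm,
    mul_div_left_comm]

namespace IsLipschitzStripLift

variable {s : ℝ} {K : NNReal} {g F : ℂ → ℂ}

theorem boundaryValue_exp (hF : IsLipschitzStripLift s K g F) (hs0 : 0 < s) (hs1 : s < 1)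
    {w : ℂ} (hw : w ∈ frontier (logStrip s)) : boundaryValue s g (Complex.exp w) = F w := by
  have hcont : Continuous fun r : ℝ ↦ F (w + r) := hF.lipschitz.continuous.comp (by fun_prop)
  refine boundaryValue_exp_eq_of_tendsto hs0 hs1 hw ((hcont.tendsto' 0 _ (by simp)).mono_left
    nhdsWithin_le_nhds |>.congr' ?_)
  filter_upwards [self_mem_nhdsWithin] with r hr using hF.eqOn hr

theorem boundaryValue_eq_log (hF : IsLipschitzStripLift s K g F) (hs0 : 0 < s) (hs1 : s < 1)
    {z : ℂ} (hz : z ∈ annulusBoundary s) : boundaryValue s g z = F (Complex.log z) := by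
  have hexp := Complex.exp_log (ne_zero_of_mem_annulusBoundary hs0 hz)
  rw [← hF.boundaryValue_exp hs0 hs1 (by rwa [frontier_logStrip hs0 hs1, Set.mem_preimage, hexp]),
    hexp]

theorem boundaryValue_deriv_exp (hF : IsLipschitzStripLift s K g F) (hs0 : 0 < s) (hs1 : s < 1)
    (hg : DifferentiableOn ℂ g (annulus s)) {w d : ℂ} (hw : w ∈ frontier (logStrip s))
    (hd : HasDerivAt (fun t : ℝ ↦ F (w.re + t * Complex.I)) d w.im) :
    boundaryValue s (deriv g) (Complex.exp w) = -Complex.I * d / Complex.exp w := by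
  have hderiv := tendsto_deriv_of_hasDerivAt_frontier hF.lipschitz (Real.log_neg hs0 hs1)
    (hF.differentiableOn hs0 hg) hw hd
  have hexp : Tendsto (fun r : ℝ ↦ Complex.exp (w + r)) (𝓝[{r | w + r ∈ logStrip s}] 0)
      (𝓝 (Complex.exp w)) :=
    (Continuous.tendsto' (by fun_prop) 0 _ (by simp)).mono_left nhdsWithin_le_nhds
  refine boundaryValue_exp_eq_of_tendsto hs0 hs1 hw
    ((hderiv.div hexp (Complex.exp_ne_zero w)).congr' ?_)
  filter_upwards [self_mem_nhdsWithin] with r hr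
  rw [Pi.div_apply, (hF.hasDerivAt hs0 hg hr).deriv,
    mul_div_cancel_right₀ _ (Complex.exp_ne_zero _)]

end IsLipschitzStripLift

/-! ### Measures on the boundary circles -/

theorem ae_of_periodic {T : ℝ} (hT : 0 < T) {p : ℝ → Prop} (hp : Function.Periodic p T)
    (h : ∀ᵐ t ∂volume.restrict (Set.Ioc 0 T), p t) : ∀ᵐ t : ℝ, p t := by
  have hfund := isAddFundamentalDomain_Ioc hT 0
  rw [zero_add] at hfund
  rw [ae_iff]
  refine hfund.measure_zero_of_invariant _ (fun g ↦ ?_) ?_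
  · obtain ⟨n, hn⟩ := AddSubgroup.mem_zmultiples_iff.1 g.2
    ext t
    have hshift : p (-(g : ℝ) + t) = p t := by
      rw [← hn, neg_add_eq_sub]
      exact hp.sub_zsmul_eq n
    rw [Set.mem_vadd_set_iff_neg_vadd_mem]
    exact not_congr hshift.to_iff
  · rw [← Measure.restrict_apply' measurableSet_Ioc]
    exact h

theorem circleMeasure_eq_smul_map (r : ℝ) :
    circleMeasure r = ENNReal.ofReal (2 * Real.pi)⁻¹ •
      Measure.map (circleMap 0 r) (volume.restrict (Set.Ioc 0 (2 * Real.pi))) := by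
  rw [circleMeasure, funext (circleMap_zero r)]

theorem ae_circleMap_of_ae_circleMeasure {r : ℝ} {p : ℂ → Prop}
    (h : ∀ᵐ z ∂circleMeasure r, p z) : ∀ᵐ θ : ℝ, p (circleMap 0 r θ) := by
  refine ae_of_periodic Real.two_pi_pos ((periodic_circleMap 0 r).comp p) ?_
  rw [circleMeasure_eq_smul_map,
    Measure.ae_ennreal_smul_measure_iff (by simp [Real.pi_pos])] at h
  exact ae_of_ae_map (measurable_circleMap 0 r).aemeasurable h

theorem sphere_subset_support_circleMeasure {r : ℝ} (hr : 0 ≤ r) :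
    Metric.sphere 0 r ⊆ (circleMeasure r).support := by
  intro z hz
  rw [← abs_of_nonneg hr, ← range_circleMap] at hz
  obtain ⟨θ, rfl⟩ := hz
  by_contra hθ
  obtain ⟨V, hV, hV0⟩ := Measure.notMem_support_iff_exists.1 hθ
  have hdense := Measure.dense_of_ae
    (ae_circleMap_of_ae_circleMeasure (measure_eq_zero_iff_ae_notMem.1 hV0))
  obtain ⟨t, ht, htV⟩ := hdense.inter_nhds_nonempty ((continuous_circleMap 0 r).continuousAt hV)
  exact ht htV

theorem ae_circleMeasure_mem_sphere {r : ℝ} (hr : 0 ≤ r) :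
    ∀ᵐ z ∂circleMeasure r, z ∈ Metric.sphere (0 : ℂ) r := by
  rw [circleMeasure_eq_smul_map]
  refine Measure.ae_smul_measure ?_ _
  exact (ae_map_iff (measurable_circleMap 0 r).aemeasurable
    Metric.isClosed_sphere.measurableSet).2 (.of_forall (circleMap_mem_sphere 0 hr))

theorem circleMeasure_univ (r : ℝ) : circleMeasure r Set.univ = 1 := by
  rw [circleMeasure_eq_smul_map, Measure.smul_apply,
    Measure.map_apply (measurable_circleMap 0 r) .univ, Set.preimage_univ,
    Measure.restrict_apply_univ, Real.volume_Ioc, smul_eq_mul,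
    ← ENNReal.ofReal_mul (by positivity), sub_zero, inv_mul_cancel₀ (by positivity),
    ENNReal.ofReal_one]

theorem mem_support_restrict_inter_annulusBoundary {s : ℝ} (hs0 : 0 ≤ s) {U : Set ℂ}
    (hU : IsOpen U) {z : ℂ} (hz : z ∈ U ∩ annulusBoundary s) :
    z ∈ ((boundaryMeasure s).restrict (U ∩ annulusBoundary s)).support := by
  have hae : annulusBoundary s ∈ ae (boundaryMeasure s) :=
    ae_add_measure_iff.2 ⟨(ae_circleMeasure_mem_sphere hs0).mono fun _ ↦ Or.inl,
      (ae_circleMeasure_mem_sphere zero_le_one).mono fun _ ↦ Or.inr⟩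
  have hsupport : annulusBoundary s ⊆ (boundaryMeasure s).support := by
    rw [boundaryMeasure, Measure.support_add]
    exact Set.union_subset_union (sphere_subset_support_circleMeasure hs0)
      (sphere_subset_support_circleMeasure zero_le_one)
  rw [Measure.restrict_congr_set (inter_ae_eq_left_of_ae_eq_univ (eventuallyEq_univ.2 hae))]
  exact Measure.interior_inter_support ⟨by rw [hU.interior_eq]; exact hz.1, hsupport hz.2⟩

theorem norm_boundaryValue_le_ae_of_linftyCircleNorm_le {s r : ℝ} {g : ℂ → ℂ} {M : NNReal}
    (h : linftyCircleNorm s r g ≤ M) :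
    ∀ᵐ θ : ℝ, ‖boundaryValue s g (circleMap 0 r θ)‖ ≤ M := by
  rw [linftyCircleNorm, eLpNorm_exponent_top] at h
  refine ae_circleMap_of_ae_circleMeasure (p := fun z ↦ ‖boundaryValue s g z‖ ≤ M) ?_
  filter_upwards [ae_le_eLpNormEssSup (f := boundaryValue s g) (μ := circleMeasure r)] with z hz
  exact_mod_cast enorm_le_coe.1 (hz.trans h)

theorem linftyCircleNorm_le {s r ε : ℝ} (hr : 0 ≤ r) {g : ℂ → ℂ}
    (h : ∀ z ∈ Metric.sphere (0 : ℂ) r, ‖boundaryValue s g z‖ ≤ ε) :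
    linftyCircleNorm s r g ≤ ENNReal.ofReal ε := by
  rw [linftyCircleNorm, eLpNorm_exponent_top]
  exact eLpNormEssSup_le_of_ae_bound ((ae_circleMeasure_mem_sphere hr).mono h)

theorem lintegral_le_two_mul_l1ArcNorm (s : ℝ) (I : Set ℂ) (f : ℂ → ℂ) :
    ∫⁻ z in I, ‖boundaryValue s f z‖ₑ ∂boundaryMeasure s ≤ 2 * l1ArcNorm s I f := by
  have hI : boundaryMeasure s I ≤ 2 := by
    refine (measure_mono (Set.subset_univ I)).trans ?_
    rw [boundaryMeasure, Measure.add_apply, circleMeasure_univ, circleMeasure_univ,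
      one_add_one_eq_two]
  have hinv : 1 ≤ 2 * (boundaryMeasure s I)⁻¹ := by
    calc (1 : ℝ≥0∞) = 2 * 2⁻¹ := (ENNReal.mul_inv_cancel (by simp) (by simp)).symm
      _ ≤ 2 * (boundaryMeasure s I)⁻¹ := by gcongr
  rw [l1ArcNorm, ← mul_assoc]
  exact le_mul_of_one_le_left' hinv

theorem tendsto_setLIntegral_of_tendsto_l1ArcNorm {ι : Type*} {l : Filter ι} {s : ℝ} {I : Set ℂ}
    {f : ι → ℂ → ℂ} (h : Tendsto (fun p ↦ l1ArcNorm s I (f p)) l (𝓝 0)) :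
    Tendsto (fun p ↦ ∫⁻ z in I, ‖boundaryValue s (f p) z‖ₑ ∂boundaryMeasure s) l (𝓝 0) := by
  have h2 : Tendsto (fun p ↦ 2 * l1ArcNorm s I (f p)) l (𝓝 0) := by
    simpa only [mul_zero] using ENNReal.Tendsto.const_mul h (.inr ENNReal.ofNat_ne_top)
  exact tendsto_of_tendsto_of_tendsto_of_le_of_le tendsto_const_nhds h2 (fun _ ↦ zero_le)
    fun p ↦ lintegral_le_two_mul_l1ArcNorm s I (f p)

/-! ### Uniform Lipschitz lifts and convergence -/

theorem lipschitzWith_comp_add_mul_I {E : Type*} [PseudoMetricSpace E] {F : ℂ → E} {K : NNReal}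
    (hF : LipschitzWith K F) (c : ℂ) :
    LipschitzWith K fun t : ℝ ↦ F (c + t * Complex.I) :=
  LipschitzWith.of_dist_le_mul fun t u ↦ by
    simpa [dist_eq_norm, ← sub_mul, ← Complex.ofReal_sub] using
      hF.dist_le_mul (c + t * Complex.I) (c + u * Complex.I)

theorem IsLipschitzStripLift.lipschitzWith_edge {s : ℝ} {K M : NNReal} {g F : ℂ → ℂ}
    (hF : IsLipschitzStripLift s K g F) (hs0 : 0 < s) (hs1 : s < 1)
    (hg : DifferentiableOn ℂ g (annulus s)) {c : ℝ} (hc : c ∈ ({Real.log s, 0} : Set ℝ))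
    (hM : linftyCircleNorm s (Real.exp c) (deriv g) ≤ M) :
    LipschitzWith M fun t : ℝ ↦ F (c + t * Complex.I) := by
  have hK := lipschitzWith_comp_add_mul_I hF.lipschitz c
  refine lipschitzWith_of_ae_norm_deriv_le hK ?_
  filter_upwards [norm_boundaryValue_le_ae_of_linftyCircleNorm_le hM, hK.ae_differentiableAt_real]
    with t ht hdiff
  set w : ℂ := c + t * Complex.I with hw
  have hwf : w ∈ frontier (logStrip s) := by
    rw [frontier_verticalStrip (Real.log_neg hs0 hs1)]
    simpa [hw] using hc
  have hexp : ‖Complex.exp w‖ ≤ 1 := by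
    rw [Complex.norm_exp, Real.exp_le_one_iff]
    rcases hc with rfl | rfl
    · simpa [hw] using (Real.log_neg hs0 hs1).le
    · simp [hw]
  have hderiv : HasDerivAt (fun t : ℝ ↦ F (w.re + t * Complex.I))
      (deriv (fun t : ℝ ↦ F (c + t * Complex.I)) t) w.im := by
    simpa [hw] using hdiff.hasDerivAt
  rw [circleMap_zero, Complex.ofReal_exp, ← Complex.exp_add,
    hF.boundaryValue_deriv_exp hs0 hs1 hg hwf hderiv, norm_div,
    div_le_iff₀ (norm_pos_iff.2 (Complex.exp_ne_zero w)), norm_mul, norm_neg, Complex.norm_I,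
    one_mul] at ht
  exact ht.trans (mul_le_of_le_one_right M.coe_nonneg hexp)

theorem exists_isLipschitzStripLift {s : ℝ} (hs0 : 0 < s) (hs1 : s < 1) {g : ℂ → ℂ}
    (hg : DifferentiableOn ℂ g (annulus s)) (hg' : MemHInfty s (deriv g)) {M : NNReal}
    (hMs : linftyCircleNorm s s (deriv g) ≤ M) (hM1 : linftyCircleNorm s 1 (deriv g) ≤ M) :
    ∃ F, IsLipschitzStripLift s (lipschitzExtensionConstant ℂ * M) g F := by
  obtain ⟨B, hB⟩ := hg'.2
  obtain ⟨F, hF⟩ := exists_isLipschitzStripLift_of_norm_deriv_le hs0 hg (M := B.toNNReal)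
    fun w hw ↦ by
      have hz := (exp_mem_annulus_iff hs0).2 hw
      rw [(hasDerivAt_comp_exp hs0 hg hw).deriv, norm_mul]
      exact (mul_le_of_le_one_right (norm_nonneg _) hz.2.le).trans
        ((hB _ hz).trans B.le_coe_toNNReal)
  refine exists_isLipschitzStripLift_of_norm_deriv_le hs0 hg fun w hw ↦ ?_
  rw [(hasDerivAt_comp_exp hs0 hg hw).deriv, ← (hF.hasDerivAt hs0 hg hw).deriv]
  exact norm_deriv_le_of_lipschitzWith_edges hF.lipschitz (hF.differentiableOn hs0 hg)
    (hF.lipschitzWith_edge hs0 hs1 hg (Or.inl rfl) (by rwa [Real.exp_log hs0]))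
    (hF.lipschitzWith_edge hs0 hs1 hg (Or.inr rfl) (by rwa [Real.exp_zero])) hw

theorem linftyCircleNorm_add_le_hardySobolevNorm (s : ℝ) {i k : ℕ} (hi : i ≤ k) (f : ℂ → ℂ) :
    linftyCircleNorm s s (iteratedDeriv i f) + linftyCircleNorm s 1 (iteratedDeriv i f) ≤
      hardySobolevNorm s k f :=
  Finset.le_sup (f := fun j ↦ linftyCircleNorm s s (iteratedDeriv j f) +
    linftyCircleNorm s 1 (iteratedDeriv j f)) (Finset.mem_range_succ_iff.2 hi)

theorem exists_isLipschitzStripLift_iteratedDeriv {s : ℝ} (hs0 : 0 < s) (hs1 : s < 1) {i k : ℕ}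
    (hi : i < k) {f : ℂ → ℂ} (hf : MemHardySobolev s k f) {M : NNReal}
    (hM : hardySobolevNorm s k f ≤ M) :
    ∃ F, IsLipschitzStripLift s (lipschitzExtensionConstant ℂ * M) (iteratedDeriv i f) F := by
  have hnorm := (linftyCircleNorm_add_le_hardySobolevNorm s (Nat.succ_le_of_lt hi) f).trans hM
  have hmem := hf (i + 1) hi
  rw [iteratedDeriv_succ] at hnorm hmem
  exact exists_isLipschitzStripLift hs0 hs1 (hf i hi.le).1 hmem (le_self_add.trans hnorm)
    (le_add_self.trans hnorm)

section Convergence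

variable {ι : Type*} {l : Filter ι} {s : ℝ} {K : NNReal} {g F : ι → ℂ → ℂ}

theorem equicontinuousWithinAt_boundaryValue (hs0 : 0 < s) (hs1 : s < 1)
    (hF : ∀ p, IsLipschitzStripLift s K (g p) (F p)) {z : ℂ} (hz : z ∈ annulusBoundary s) :
    EquicontinuousWithinAt (fun p ↦ boundaryValue s (g p)) (annulusBoundary s) z := by
  have hz0 := ne_zero_of_mem_annulusBoundary hs0 hz
  have hbv {u : ℂ} (hu : u ∈ annulusBoundary s) (p : ι) :
      boundaryValue s (g p) u = F p (Complex.log z + Complex.log (u / z)) := by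
    have hexp : Complex.exp (Complex.log z + Complex.log (u / z)) = u := by
      rw [Complex.exp_add, Complex.exp_log hz0, Complex.exp_log
        (div_ne_zero (ne_zero_of_mem_annulusBoundary hs0 hu) hz0), mul_div_cancel₀ _ hz0]
    rw [← (hF p).boundaryValue_exp hs0 hs1
      (by rwa [frontier_logStrip hs0 hs1, Set.mem_preimage, hexp]), hexp]
  have hlog : Tendsto (fun u ↦ Complex.log z + Complex.log (u / z)) (𝓝 z)
      (𝓝 (Complex.log z + Complex.log (z / z))) := by
    refine ((continuousAt_id.div_const z).clog ?_).const_add _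
    simp [div_self hz0]
  intro V hV
  filter_upwards [self_mem_nhdsWithin, (hlog.mono_left nhdsWithin_le_nhds).eventually
    (equicontinuous_of_lipschitzWith (fun p ↦ (hF p).lipschitz) _ V hV)] with u hu hV p
  rw [hbv hz p, hbv hu p]
  exact hV p

theorem tendsto_boundaryValue_of_tendsto_l1ArcNorm (hs0 : 0 < s) (hs1 : s < 1)
    (hF : ∀ p, IsLipschitzStripLift s K (g p) (F p)) {U : Set ℂ} (hU : IsOpen U)
    (hL1 : Tendsto (fun p ↦ l1ArcNorm s (U ∩ annulusBoundary s) (g p)) l (𝓝 0)) {z : ℂ}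
    (hz : z ∈ U ∩ annulusBoundary s) : Tendsto (fun p ↦ boundaryValue s (g p) z) l (𝓝 0) :=
  tendsto_zero_of_tendsto_setLIntegral
    (hU.measurableSet.inter
      (Metric.isClosed_sphere.union Metric.isClosed_sphere).measurableSet)
    (mem_support_restrict_inter_annulusBoundary hs0.le hU hz)
    ((equicontinuousWithinAt_boundaryValue hs0 hs1 hF hz.2).mono Set.inter_subset_right)
    (tendsto_setLIntegral_of_tendsto_l1ArcNorm hL1)

theorem tendsto_zero_on_annulus_iff (hs0 : 0 < s)
    (hF : ∀ p, IsLipschitzStripLift s K (g p) (F p)) :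
    (∀ z ∈ annulus s, Tendsto (g · z) l (𝓝 0)) ↔ ∀ w ∈ logStrip s, Tendsto (F · w) l (𝓝 0) := by
  have heq {w : ℂ} (hw : w ∈ logStrip s) : (F · w) = (g · (Complex.exp w)) :=
    funext fun p ↦ (hF p).eqOn hw
  constructor
  · intro h w hw
    simpa only [heq hw] using h _ ((exp_mem_annulus_iff hs0).2 hw)
  · intro h z hz
    have hw := log_mem_logStrip hs0 hz
    simpa only [heq hw, exp_log_of_mem_annulus hs0 hz] using h _ hw

theorem tendsto_zero_of_tendsto_l1ArcNorm (hs0 : 0 < s) (hs1 : s < 1)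
    (hF : ∀ p, IsLipschitzStripLift s K (g p) (F p))
    (hg : ∀ p, DifferentiableOn ℂ (g p) (annulus s)) {U : Set ℂ} (hU : IsOpen U)
    (hne : (U ∩ annulusBoundary s).Nonempty)
    (hL1 : Tendsto (fun p ↦ l1ArcNorm s (U ∩ annulusBoundary s) (g p)) l (𝓝 0)) :
    ∀ z ∈ annulus s, Tendsto (g · z) l (𝓝 0) := by
  obtain ⟨z₀, hz₀U, hz₀⟩ := hne
  have hexp : Complex.exp (Complex.log z₀) = z₀ :=
    Complex.exp_log (ne_zero_of_mem_annulusBoundary hs0 hz₀)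
  refine (tendsto_zero_on_annulus_iff hs0 hF).2 fun w hw ↦
    tendsto_zero_of_tendsto_zero_frontier (isOpen_verticalStrip _ _) (convex_verticalStrip _ _)
      (fun p ↦ (hF p).lipschitz) (.of_forall fun p ↦ (hF p).differentiableOn hs0 (hg p))
      (w₀ := Complex.log z₀) ?_ ?_ hw
  · rwa [frontier_logStrip hs0 hs1, Set.mem_preimage, hexp]
  · have hU' : Complex.exp ⁻¹' U ∈ 𝓝 (Complex.log z₀) :=
      Complex.continuous_exp.continuousAt (hU.mem_nhds (by rwa [hexp]))
    filter_upwards [self_mem_nhdsWithin, mem_nhdsWithin_of_mem_nhds hU'] with v hv hvU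
    simp only [← (hF _).boundaryValue_exp hs0 hs1 hv]
    rw [frontier_logStrip hs0 hs1] at hv
    exact tendsto_boundaryValue_of_tendsto_l1ArcNorm hs0 hs1 hF hU hL1 ⟨hvU, hv⟩

theorem tendsto_deriv_zero_on_annulus (hs0 : 0 < s)
    (hF : ∀ p, IsLipschitzStripLift s K (g p) (F p))
    (hg : ∀ p, DifferentiableOn ℂ (g p) (annulus s))
    (h : ∀ z ∈ annulus s, Tendsto (g · z) l (𝓝 0)) :
    ∀ z ∈ annulus s, Tendsto (fun p ↦ deriv (g p) z) l (𝓝 0) := by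
  intro z hz
  have hexp := exp_log_of_mem_annulus hs0 hz
  have hw := log_mem_logStrip hs0 hz
  have hlim := (tendsto_deriv_of_lipschitzWith (isOpen_verticalStrip _ _)
    (fun p ↦ (hF p).lipschitz) (.of_forall fun p ↦ (hF p).differentiableOn hs0 (hg p))
    ((tendsto_zero_on_annulus_iff hs0 hF).1 h) hw).div_const (Complex.exp (Complex.log z))
  rw [deriv_const, zero_div] at hlim
  refine hlim.congr fun p ↦ ?_
  rw [((hF p).hasDerivAt hs0 (hg p) hw).deriv, mul_div_cancel_right₀ _ (Complex.exp_ne_zero _),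
    hexp]

theorem tendsto_linftyCircleNorm_zero (hs0 : 0 < s) (hs1 : s < 1)
    (hF : ∀ p, IsLipschitzStripLift s K (g p) (F p))
    (h : ∀ z ∈ annulus s, Tendsto (g · z) l (𝓝 0)) {r : ℝ} (hr0 : 0 ≤ r)
    (hr : Metric.sphere 0 r ⊆ annulusBoundary s) :
    Tendsto (fun p ↦ linftyCircleNorm s r (g p)) l (𝓝 0) := by
  have hlog := Real.log_neg hs0 hs1
  have hequi := equicontinuous_of_lipschitzWith fun p ↦ (hF p).lipschitz
  set S : Set ℂ := Set.Icc (Real.log s) 0 ×ℂ Set.Icc (-Real.pi) Real.pi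
  have hS : S ⊆ closure (logStrip s) := by
    rw [closure_verticalStrip hlog]
    exact Set.inter_subset_left
  have hunif : TendstoUniformlyOn F 0 l S :=
    tendstoUniformlyOn_of_equicontinuousOn (isCompact_Icc.reProdIm isCompact_Icc)
      (hequi.equicontinuousOn S) fun w hw ↦ (hequi w).tendsto_of_mem_closure
        (continuousWithinAt_const (b := (0 : ℂ))) ((tendsto_zero_on_annulus_iff hs0 hF).1 h) (hS hw)
  refine ENNReal.tendsto_nhds_zero.2 fun ε hε ↦ ?_
  obtain ⟨e, he0, heε⟩ := ENNReal.lt_iff_exists_nnreal_btwn.1 hε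
  filter_upwards [Metric.tendstoUniformlyOn_iff.1 hunif e (by exact_mod_cast he0)] with p hp
  refine (linftyCircleNorm_le hr0 (ε := e) fun z hz ↦ ?_).trans (by simpa using heε.le)
  rw [(hF p).boundaryValue_eq_log hs0 hs1 (hr hz)]
  have hre : Complex.log z ∈ closure (logStrip s) := by
    refine frontier_subset_closure ?_
    rw [frontier_logStrip hs0 hs1, Set.mem_preimage,
      Complex.exp_log (ne_zero_of_mem_annulusBoundary hs0 (hr hz))]
    exact hr hz
  rw [closure_verticalStrip hlog] at hre
  simpa using (hp (Complex.log z)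
    ⟨hre, (Complex.neg_pi_lt_log_im z).le, Complex.log_im_le_pi z⟩).le

theorem tendsto_hardySobolevNorm_zero {j : ℕ} {f : ι → ℂ → ℂ}
    (hs : ∀ i ≤ j, Tendsto (fun p ↦ linftyCircleNorm s s (iteratedDeriv i (f p))) l (𝓝 0))
    (h1 : ∀ i ≤ j, Tendsto (fun p ↦ linftyCircleNorm s 1 (iteratedDeriv i (f p))) l (𝓝 0)) :
    Tendsto (fun p ↦ hardySobolevNorm s j (f p)) l (𝓝 0) := by
  refine ENNReal.tendsto_nhds_zero.2 fun ε hε ↦ ?_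
  have hall : ∀ i ∈ Finset.range (j + 1), ∀ᶠ p in l, linftyCircleNorm s s (iteratedDeriv i (f p)) +
      linftyCircleNorm s 1 (iteratedDeriv i (f p)) ≤ ε := by
    intro i hi
    rw [Finset.mem_range_succ_iff] at hi
    have hadd := (hs i hi).add (h1 i hi)
    rw [add_zero] at hadd
    exact ENNReal.tendsto_nhds_zero.1 hadd ε hε
  filter_upwards [(Finset.eventually_all _).2 hall] with p hp using Finset.sup_le hp

end Convergence

theorem corollary3p9_general {ι : Type*} {l : Filter ι} {s : ℝ} (hs0 : 0 < s) (hs1 : s < 1)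
    {j k : ℕ} (hjk : j < k) {U : Set ℂ} (hU : IsOpen U) (hne : (U ∩ annulusBoundary s).Nonempty)
    {f : ι → ℂ → ℂ} (hf : ∀ p, MemHardySobolev s k (f p)) {M : NNReal}
    (hM : ∀ p, hardySobolevNorm s k (f p) ≤ M)
    (hL1 : Tendsto (fun p ↦ l1ArcNorm s (U ∩ annulusBoundary s) (f p)) l (𝓝 0)) :
    Tendsto (fun p ↦ hardySobolevNorm s j (f p)) l (𝓝 0) := by
  have hlift (i : ℕ) (hi : i < k) (p : ι) :=
    exists_isLipschitzStripLift_iteratedDeriv hs0 hs1 hi (hf p) (hM p)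
  choose F hF using hlift
  have hinside (i : ℕ) (hi : i < k) :
      ∀ z ∈ annulus s, Tendsto (fun p ↦ iteratedDeriv i (f p) z) l (𝓝 0) := by
    induction i with
    | zero =>
      simp only [iteratedDeriv_zero] at hF ⊢
      exact tendsto_zero_of_tendsto_l1ArcNorm hs0 hs1 (hF 0 hi) (fun p ↦ (hf p 0 k.zero_le).1) hU
        hne hL1
    | succ i ih =>
      have hi' : i < k := i.lt_succ_self.trans hi
      simp only [iteratedDeriv_succ]
      exact tendsto_deriv_zero_on_annulus hs0 (hF i hi') (fun p ↦ (hf p i hi'.le).1) (ih hi')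
  have hedge {r : ℝ} (hr0 : 0 ≤ r) (hr : Metric.sphere 0 r ⊆ annulusBoundary s) (i : ℕ)
      (hi : i ≤ j) : Tendsto (fun p ↦ linftyCircleNorm s r (iteratedDeriv i (f p))) l (𝓝 0) :=
    have hik := hi.trans_lt hjk
    tendsto_linftyCircleNorm_zero hs0 hs1 (hF i hik) (hinside i hik) hr0 hr
  exact tendsto_hardySobolevNorm_zero (hedge hs0.le Set.subset_union_left)
    (hedge zero_le_one Set.subset_union_right)

end

theorem corollary3p9 (s : ℝ) (hs0 : 0 < s) (hs1 : s < 1) (j k : ℕ) (hjk : j < k)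
    (I : Set ℂ) (hI : IsOpenBoundaryArc s I)
    (f : ℕ → ℂ → ℂ) (hf : ∀ p, f p ∈ hardySobolevUnitBall s k)
    (hL1 : Tendsto (fun p => l1ArcNorm s I (f p)) atTop (𝓝 0)) :
    Tendsto (fun p => hardySobolevNorm s j (f p)) atTop (𝓝 0) := by
  obtain ⟨⟨hne, -⟩, U, hU, rfl⟩ := hI
  exact corollary3p9_general hs0 hs1 hjk hU hne (fun p ↦ (hf p).1) (fun p ↦ (hf p).2) hL1
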